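/- All rings are commutative with unity, and a local ring is Noetherian by definition. A local ring $R$, with completion $\widehat R$ at its maximal ideal, is called quasi-excellent if for every $P \in \operatorname{Spec}(R)$ and every finite field extension $L$ of $R_P/PR_P$ the ring $\widehat R \otimes_R L$ is regular. Let $(S,M)$ be a reduced local ring containing the rationals, with $S/M$ uncountable and $|S| = |S/M|$, and let the set $\operatorname{Min}(S)$ of minimal prime ideals of $S$ be partitioned into $m \geq 1$ subcollections $C_1, \ldots, C_m$. Let $B \subseteq S$ be a subring that is a reduced local ring with maximal ideal $B \cap M$ and is obtained from $S$ by gluing minimal primes along this partition, that is: 1. $B$ contains the rationals; 2. $\widehat B = \widehat S$, that is, there is a ring isomorphism $\widehat B \to \widehat S$ compatible with the inclusion $B \subseteq S$; 3. $B/(B \cap M)$ is uncountable and $|B| = |B/(B \cap M)|$; 4. for $Q, Q' \in \operatorname{Min}(S)$, $Q \cap B = Q' \cap B$ if and only if there is an $i$ with $Q \in C_i$ and $Q' \in C_i$; 5. the map $f : \operatorname{Spec}(S) \to \operatorname{Spec}(B)$, $f(P) = B \cap P$, is onto, and if $P$ is a prime ideal of $S$ of positive height, then $f(P)S = P$; in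 particular, if $P$ and $P'$ are prime ideals of $S$ of positive height, then $f(P)$ has positive height, and $f(P) = f(P')$ implies $P = P'$. If $S$ is quasi-excellent, then $B$ is quasi-excellent. -/

import Mathlib

open IsLocalRing TensorProduct

universe u

/-- A Noetherian local ring `R` with completion `R̂` at its maximal ideal is quasi-excellent if,
for every prime ideal `P` of `R` and every finite field extension `L` of the residue field
`κ(P) = R_P / P R_P`, the ring `R̂ ⊗_R L` is regular. A finite extension of `κ(P)` always has an
isomorphic copy in the universe of `R`. -/
def IsQuasiExcellentLocalRing (R : Type u) [CommRing R] [IsLocalRing R] : Prop :=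
  IsNoetherianRing R ∧
    ∀ (P : Ideal R) [P.IsPrime] (L : Type u) [Field L] [Algebra P.ResidueField L]
      [FiniteDimensional P.ResidueField L] [Algebra R L] [IsScalarTower R P.ResidueField L],
      IsRegularRing (AdicCompletion (maximalIdeal R) R ⊗[R] L)

/-- `C 0, …, C (m - 1)` is a partition of the set of minimal prime ideals of `S`. -/
structure IsPartitionOfMinimalPrimes {S : Type u} [CommRing S] {m : ℕ}
    (C : Fin m → Set (Ideal S)) : Prop where
  nonempty : ∀ i, (C i).Nonempty
  disjoint : ∀ i j, i ≠ j → Disjoint (C i) (C j)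
  iUnion_eq : ⋃ i, C i = minimalPrimes S

/-- The local subring `B` of the local ring `(S, M)` is obtained from `S` by gluing its minimal
prime ideals along the subcollections `C i`. -/
structure IsGluedSubring {S : Type u} [CommRing S] [IsLocalRing S] [Algebra ℚ S] {m : ℕ}
    (C : Fin m → Set (Ideal S)) (B : Subring S) [IsLocalRing B] : Prop where
  /-- `B` is Noetherian. -/
  isNoetherianRing : IsNoetherianRing B
  /-- `B` is reduced. -/
  isReduced : IsReduced B
  /-- The maximal ideal of `B` is `B ∩ M`. -/
  maximalIdeal_eq : maximalIdeal B = (maximalIdeal S).comap B.subtype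
  /-- `B` contains the rationals. -/
  rat_mem : ∀ q : ℚ, algebraMap ℚ S q ∈ B
  /-- The completions of `B` and `S` agree, compatibly with the inclusion of `B` in `S`. -/
  completion_eq : ∃ e : AdicCompletion (maximalIdeal B) B ≃+* AdicCompletion (maximalIdeal S) S,
    ∀ b : B, e (algebraMap B _ b) = algebraMap S _ (b : S)
  /-- The residue field of `B` is uncountable. -/
  uncountable_residueField : Uncountable (ResidueField B)
  /-- `B` has the cardinality of its residue field. -/
  card_eq : Cardinal.mk B = Cardinal.mk (ResidueField B)
  /-- Two minimal primes of `S` have the same contraction to `B` exactly when they lie in the same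
  subcollection. -/
  comap_eq_iff : ∀ Q ∈ minimalPrimes S, ∀ Q' ∈ minimalPrimes S,
    Q.comap B.subtype = Q'.comap B.subtype ↔ ∃ i, Q ∈ C i ∧ Q' ∈ C i
  /-- The map `Spec S → Spec B`, `P ↦ B ∩ P`, is onto. -/
  comap_surjective : Function.Surjective (PrimeSpectrum.comap B.subtype)
  /-- `(B ∩ P) S = P` for every prime `P` of `S` of positive height. -/
  map_comap_eq : ∀ P : Ideal S, P.IsPrime → 0 < P.height →
    (P.comap B.subtype).map B.subtype = P
  /-- Primes of positive height contract to primes of positive height. -/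
  height_comap_pos : ∀ P : Ideal S, P.IsPrime → 0 < P.height → 0 < (P.comap B.subtype).height
  /-- Primes of positive height are determined by their contractions. -/
  comap_inj : ∀ P P' : Ideal S, P.IsPrime → P'.IsPrime → 0 < P.height → 0 < P'.height →
    P.comap B.subtype = P'.comap B.subtype → P = P'

/-! Since `B` and `S` have the same completion, the ring to study is `Ŝ ⊗_B L = Ŝ ⊗_S F` with `F = S
⊗_B L`. In characteristic zero `L` is unramified over `B`, hence `F` over `S`. For each prime `Q` of
`S` over `P`, gluing gives `P S_Q = Q S_Q`, while `P` dies in `L`; so the local rings of `F` are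
fields. Being Noetherian, `F` is a finite product of fields, each finite over a residue field of
`S`, and quasi-excellence of `S` applies to each factor. -/

lemma IsRegularRing.pi {ι : Type*} [Finite ι] (R : ι → Type*) [∀ i, CommRing (R i)]
    [∀ i, IsRegularRing (R i)] : IsRegularRing (∀ i, R i) := by
  rw [isRegularRing_iff]
  intro q hq
  obtain ⟨i, p, h⟩ := PrimeSpectrum.exists_comap_evalRingHom_eq ⟨q, hq⟩
  obtain rfl : p.asIdeal.comap (Pi.evalRingHom R i) = q := congrArg PrimeSpectrum.asIdeal h
  exact .of_ringEquiv (RingEquiv.ofBijective _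
    (Localization.AtPrime.mapPiEvalRingHom_bijective p.asIdeal)).symm

/-- Let `F` be an unramified `S`-algebra and `n` a prime of `F` over the prime `Q` of `S`. If the
maximal ideal of `S_Q` is extended from an ideal of `S` that dies in `F`, then `F_n` is a field. -/
lemma Algebra.FormallyUnramified.isField_localization {S F : Type*} [CommRing S] [CommRing F]
    [Algebra S F] [Algebra.FormallyUnramified S F] [Algebra.EssFiniteType S F]
    (n : Ideal F) [n.IsPrime] (J : Ideal S) (hJ : J.map (algebraMap S F) = ⊥)
    (h : J.map (algebraMap S (Localization.AtPrime (n.under S))) = maximalIdeal _) :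
    IsField (Localization.AtPrime n) := by
  let := Localization.AtPrime.algebraOfLiesOver (n.under S) n
  have : Algebra.EssFiniteType F (Localization.AtPrime n) :=
    .of_isLocalization _ n.primeCompl
  have : Algebra.EssFiniteType (Localization.AtPrime (n.under S)) (Localization.AtPrime n) :=
    .of_comp S _ _
  -- Unramifiedness makes the maximal ideal of `S_Q` generate that of `F_n`, which is then the
  -- extension of `J`, hence zero.
  rw [isField_iff_maximalIdeal_eq,
    ← map_maximalIdeal (R := Localization.AtPrime (n.under S)), ← h, Ideal.map_map,
    ← IsScalarTower.algebraMap_eq, IsScalarTower.algebraMap_eq S F, ← Ideal.map_map, hJ,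
    Ideal.map_bot]

/-- A Noetherian ring whose local rings are fields is Artinian and reduced. -/
lemma IsArtinianRing.of_forall_isField_localization {F : Type*} [CommRing F] [IsNoetherianRing F]
    (hF : ∀ (n : Ideal F) [n.IsPrime], IsField (Localization.AtPrime n)) :
    IsArtinianRing F ∧ IsReduced F := by
  refine ⟨?_, isReduced_ofLocalizationMaximal F fun n _ ↦ ?_⟩
  · rw [isArtinianRing_iff_krullDimLE_zero]
    refine .mk₀ fun p hp ↦ ?_
    obtain ⟨n, hn, hpn⟩ := p.exists_le_maximal hp.ne_top
    -- The field `F_n` has a single prime, so `n` contains no smaller prime.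
    have hbot (r : Ideal F) [r.IsPrime] (hrn : r ≤ n) :
        r = (⊥ : Ideal (Localization.AtPrime n)).under F := by
      let := (hF n).toField
      have hr := n.isPrime_map_of_isLocalizationAtPrime hrn (S := Localization.AtPrime n)
      rw [← Ideal.under_map_of_isLocalizationAtPrime n hrn (S := Localization.AtPrime n)]
      congr 1
      exact Ideal.eq_bot_of_prime _
    rwa [hbot p hpn, ← hbot n le_rfl]
  · let := (hF n).toField
    exact inferInstanceAs (IsReduced (Localization.AtPrime n))

/-- Regularity of `A ⊗ F` for a reduced Artinian ring `F` is tested on the residue fields. -/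
lemma IsRegularRing.tensorProduct_of_residueField {S A F : Type*} [CommRing S] [CommRing A]
    [CommRing F] [Algebra S A] [Algebra S F] [IsArtinianRing F] [IsReduced F]
    (h : ∀ (n : Ideal F) [n.IsPrime], IsRegularRing (A ⊗[S] n.ResidueField)) :
    IsRegularRing (A ⊗[S] F) := by
  classical
  have := Fintype.ofFinite (MaximalSpectrum F)
  have (n : MaximalSpectrum F) : IsRegularRing (A ⊗[S] (F ⧸ n.asIdeal)) := by
    have := h n.asIdeal
    let e : (F ⧸ n.asIdeal) ≃ₐ[S] n.asIdeal.ResidueField :=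
      .ofBijective (IsScalarTower.toAlgHom S (F ⧸ n.asIdeal) n.asIdeal.ResidueField)
        n.asIdeal.bijective_algebraMap_quotient_residueField
    exact .of_ringEquiv (Algebra.TensorProduct.congr (.refl : A ≃ₐ[S] A) e).symm.toRingEquiv
  have := IsRegularRing.pi fun n : MaximalSpectrum F ↦ A ⊗[S] (F ⧸ n.asIdeal)
  exact .of_ringEquiv ((Algebra.TensorProduct.congr (.refl : A ≃ₐ[S] A)
    ((IsArtinianRing.equivPi F).restrictScalars S)).trans
      (Algebra.TensorProduct.piRight S S A _)).symm.toRingEquiv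

/-- A finite separable extension of a residue field of `R` is unramified over `R`. -/
lemma Algebra.FormallyUnramified.of_residueField {R L : Type*} [CommRing R] (P : Ideal R)
    [P.IsPrime] [Field L] [Algebra P.ResidueField L] [Algebra.IsSeparable P.ResidueField L]
    [Algebra R L] [IsScalarTower R P.ResidueField L] : Algebra.FormallyUnramified R L := by
  have : Algebra.FormallyUnramified R (Localization.AtPrime P) :=
    .of_isLocalization P.primeCompl
  have : Algebra.FormallyUnramified (Localization.AtPrime P) P.ResidueField :=
    .of_surjective (Algebra.ofId _ _) residue_surjective
  have : Algebra.FormallyUnramified R P.ResidueField := .comp _ (Localization.AtPrime P) _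
  have := Algebra.FormallyUnramified.of_isSeparable P.ResidueField L
  exact .comp _ P.ResidueField _

/-- Let `P` be a prime of `R` such that `P S_Q` is the maximal ideal of `S_Q` for every prime `Q` of
`S` over `P`. If `S` is quasi-excellent, then `Ŝ ⊗_R L` is regular for every finite separable
extension `L` of the residue field of `P`. -/
theorem IsQuasiExcellentLocalRing.isRegularRing_tensorProduct {R S : Type u} [CommRing R]
    [CommRing S] [IsLocalRing S] [Algebra R S] (hS : IsQuasiExcellentLocalRing S) (P : Ideal R) [P.IsPrime]
    (hP : ∀ (Q : Ideal S) [Q.IsPrime], Q.under R = P →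
      (P.map (algebraMap R S)).map (algebraMap S (Localization.AtPrime Q)) = maximalIdeal _)
    (L : Type u) [Field L] [Algebra P.ResidueField L] [FiniteDimensional P.ResidueField L]
    [Algebra.IsSeparable P.ResidueField L] [Algebra R L] [IsScalarTower R P.ResidueField L] :
    IsRegularRing (AdicCompletion (maximalIdeal S) S ⊗[R] L) := by
  have : Algebra.FormallyUnramified R L := .of_residueField P
  have : Algebra.EssFiniteType R L := .comp _ P.ResidueField _
  have hPL : P.map (algebraMap R L) = ⊥ := by
    rw [IsScalarTower.algebraMap_eq R P.ResidueField L, ← Ideal.map_map]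
    rw [show P.map (algebraMap R P.ResidueField) = ⊥ from
      (Ideal.map_eq_bot_iff_le_ker _).mpr P.ker_algebraMap_residueField.ge, Ideal.map_bot]
  have hker : RingHom.ker (algebraMap R L) = P := by
    rw [IsScalarTower.algebraMap_eq R P.ResidueField L, ← RingHom.comap_ker,
      (RingHom.injective_iff_ker_eq_bot _).mp (algebraMap P.ResidueField L).injective]
    exact P.ker_algebraMap_residueField
  have htower : algebraMap R (S ⊗[R] L) =
      (Algebra.TensorProduct.includeRight : L →ₐ[R] S ⊗[R] L).toRingHom.comp (algebraMap R L) :=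
    (AlgHom.comp_algebraMap (Algebra.TensorProduct.includeRight : L →ₐ[R] S ⊗[R] L)).symm
  have : IsNoetherianRing S := hS.1
  have : IsNoetherianRing (S ⊗[R] L) := Algebra.EssFiniteType.isNoetherianRing S _
  obtain ⟨_, _⟩ := IsArtinianRing.of_forall_isField_localization (F := S ⊗[R] L) fun n _ ↦ by
    refine Algebra.FormallyUnramified.isField_localization n (P.map (algebraMap R S)) ?_ (hP _ ?_)
    · rw [Ideal.map_map, ← IsScalarTower.algebraMap_eq, htower, ← Ideal.map_map, hPL,
        Ideal.map_bot]
    -- The contraction of `n` to `R` passes through the field `L`, where it is zero.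
    · rw [Ideal.under_under, Ideal.under_def, htower, ← Ideal.comap_comap,
        Ideal.eq_bot_of_prime (n.comap _)]
      exact hker
  have : IsRegularRing (AdicCompletion (maximalIdeal S) S ⊗[S] (S ⊗[R] L)) := by
    refine .tensorProduct_of_residueField fun n _ ↦ ?_
    let := Localization.AtPrime.algebraOfLiesOver (n.under S) n
    -- This extension is finite because `S ⊗[R] L` is unramified and essentially of finite type over
    -- `S`.
    exact hS.2 (n.under S) n.ResidueField
  exact .of_ringEquiv (Algebra.TensorProduct.cancelBaseChange R S S
    (AdicCompletion (maximalIdeal S) S) L).toRingEquiv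

theorem mainTheorem11 {S : Type u} [CommRing S] [IsLocalRing S] [IsNoetherianRing S]
    [IsReduced S] [Algebra ℚ S] [Uncountable (ResidueField S)]
    (hcard : Cardinal.mk S = Cardinal.mk (ResidueField S))
    {m : ℕ} (hm : 1 ≤ m) (C : Fin m → Set (Ideal S)) (hC : IsPartitionOfMinimalPrimes C)
    (B : Subring S) [IsLocalRing B] (hB : IsGluedSubring C B)
    (hS : IsQuasiExcellentLocalRing S) :
    IsQuasiExcellentLocalRing B := by
  refine ⟨hB.isNoetherianRing, fun P _ L _ _ _ _ _ ↦ ?_⟩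
  let : Algebra ℚ B := ((algebraMap ℚ S).codRestrict B hB.rat_mem).toAlgebra
  let : Algebra ℚ P.ResidueField := ((algebraMap B P.ResidueField).comp (algebraMap ℚ B)).toAlgebra
  have : CharZero P.ResidueField := algebraRat.charZero _
  have hfib (Q : Ideal S) [Q.IsPrime] (hQ : Q.under B = P) :
      (P.map (algebraMap B S)).map (algebraMap S (Localization.AtPrime Q)) = maximalIdeal _ := by
    subst hQ
    rcases eq_or_ne Q.height 0 with h0 | h0
    -- At a minimal prime the reduced ring `S_Q` is a field, so both ideals vanish.
    · have := Ring.KrullDimLE.of_isLocalization Q (Ideal.height_eq_zero_iff.mp h0)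
        (Localization.AtPrime Q)
      have hbot : maximalIdeal (Localization.AtPrime Q) = ⊥ :=
        isField_iff_maximalIdeal_eq.mp Ring.KrullDimLE.isField_of_isReduced
      rw [hbot, eq_bot_iff, ← hbot, ← Localization.AtPrime.map_eq_maximalIdeal]
      exact Ideal.map_mono Ideal.map_comap_le
    · have := hB.map_comap_eq Q ‹_› (pos_of_ne_zero h0)
      rw [← Localization.AtPrime.map_eq_maximalIdeal]
      exact congrArg _ this
  have := hS.isRegularRing_tensorProduct P hfib L
  obtain ⟨e, he⟩ := hB.completion_eq
  let e' : AdicCompletion (maximalIdeal B) B ≃ₐ[B] AdicCompletion (maximalIdeal S) S :=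
    AlgEquiv.ofRingEquiv (f := e) he
  exact .of_ringEquiv (Algebra.TensorProduct.congr e' (.refl : L ≃ₐ[B] L)).symm.toRingEquiv
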